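/- Let $K\subset\mathbf R^d$ be a non-empty closed convex set, let $\Omega=\mathbf R^d\setminus K$, let $d_H$ be the Hausdorff dimension of the boundary $\Gamma=\partial\Omega$ of $\Omega$, and let $d_\Gamma(x)=\inf_{y\in\Omega^c}|x-y|$ for $x\in\Omega$. Let $\delta,\delta'\in[0,2)$, put $c_\Omega=c\circ d_\Gamma$ with $c(s)=s^{\delta}(1+s)^{\delta'-\delta}$, and let $H\varphi=-\sum_{k=1}^d\partial_k(c_\Omega\,\partial_k\varphi)$. If $d-d_H+2(\delta\wedge\delta')-4>0$, then for every real-valued $\varphi\in C_c^2(\Omega)$ the functions $c_\Omega\,\partial_k\varphi$ are differentiable on $\Omega$ (so that $H\varphi$ is defined pointwise), both integrals below are finite, and $$\int_\Omega |H\varphi|^2\;\ge\; C_2^{\,2}\int_\Omega |c_\Omega\, d_\Gamma^{-2}\varphi|^2,\qquad C_2=\frac{(d-d_H)\,\bigl(d-d_H+2(\delta\wedge\delta')-4\bigr)}{4}.$$ -/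

import Mathlib

open MeasureTheory

noncomputable section

/-- The distance `d_Γ` to the boundary `Γ = ∂Ω`, i.e. `d_Γ(x) = inf_{y ∈ Ωᶜ} |x - y|`. -/
def boundaryDist {d : ℕ} (Ω : Set (EuclideanSpace ℝ (Fin d))) (x : EuclideanSpace ℝ (Fin d)) : ℝ :=
  Metric.infDist x Ωᶜ

/-- The Hausdorff dimension `d_H` of the boundary `Γ = ∂Ω`, as a real number. (It is at most `d`,
so that `toReal` only changes the type.) -/
def boundaryDim {d : ℕ} (Ω : Set (EuclideanSpace ℝ (Fin d))) : ℝ :=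
  (dimH (frontier Ω)).toReal

/-- The profile `c(s) = s ^ δ * (1 + s) ^ (δ' - δ)`, behaving like `s ^ δ` as `s → 0` and
like `s ^ δ'` as `s → ∞`. -/
def weightProfile (δ δ' : ℝ) (s : ℝ) : ℝ :=
  s ^ δ * (1 + s) ^ (δ' - δ)

/-- The weight `c_Ω = c ∘ d_Γ`. -/
def weight {d : ℕ} (Ω : Set (EuclideanSpace ℝ (Fin d))) (δ δ' : ℝ)
    (x : EuclideanSpace ℝ (Fin d)) : ℝ :=
  weightProfile δ δ' (boundaryDist Ω x)

/-- The partial derivative `∂_k f`. -/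
def partialDeriv {d : ℕ} (k : Fin d) (f : EuclideanSpace ℝ (Fin d) → ℝ)
    (x : EuclideanSpace ℝ (Fin d)) : ℝ :=
  fderiv ℝ f x (EuclideanSpace.single k (1 : ℝ))

/-- The divergence form operator `H φ = -∑ₖ ∂ₖ (a ∂ₖ φ) = -div (a ∇φ)` with coefficient `a`. -/
def divFormOp {d : ℕ} (a φ : EuclideanSpace ℝ (Fin d) → ℝ) (x : EuclideanSpace ℝ (Fin d)) : ℝ :=
  -∑ k : Fin d, partialDeriv k (fun y => a y * partialDeriv k φ y) x

/-- The real-valued `C²` functions with compact support in `Ω` (extended by zero to `ℝᵈ`). -/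
structure IsCc2 {d : ℕ} (Ω : Set (EuclideanSpace ℝ (Fin d)))
    (φ : EuclideanSpace ℝ (Fin d) → ℝ) : Prop where
  contDiff : ContDiff ℝ 2 φ
  hasCompactSupport : HasCompactSupport φ
  tsupport_subset : tsupport φ ⊆ Ω

end

/-! ### Dimension of the boundary of a closed convex set. -/

section Dimension

open Module

/-! Let D be the distance to K, P the nearest point projection, F(x) = x - P x = D∇D, and W =
c(D)/D². Green's formula turns ∫ Hφ · Wφ into ∫ W²(D²|∇φ|² + (e - 2) φ F·∇φ), where e(s) = s
c'(s)/c(s) is evaluated at D. It is enough to bound this below by C ∫ |Wφ|² with C ≥ C₂, since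
Cauchy–Schwarz then gives the claim (`sq_mul_integral_sq_le_of_mul_integral_sq_le`).

Convexity enters only through div F ≥ m in the weak sense, with m ≥ 1 and m ≥ d - d_H
(`exists_codim_le_weakDiv`). If K has empty interior, m is the codimension of its affine hull,
because F is strongly monotone in the normal directions. Otherwise m = 1: D is convex, so div(D∇D) =
|∇D|² + DΔD ≥ 1, while the boundary has dimension at least d - 1.

The weak bound is tested on Gφ² with G = W²(α + (2 - e)/2) and α = (m + 2(δ∧δ') - 4)/2. Adding
∇(Gφ²)·F + mGφ², whose integral is at most 0, replaces the cross term by 2α W²φ F·∇φ. Since D²|∇φ|²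
≥ (F·∇φ)², completing the square leaves a scalar inequality in D (`rellich_pointwise`,
`rellich_scalar_inequality`). -/

theorem IsPreconnected.exists_mem_frontier_of_isClosed {X : Type*} [TopologicalSpace X]
    {s t : Set X} (hs : IsPreconnected s) (ht : IsClosed t) (h1 : (s ∩ t).Nonempty)
    (h2 : (s ∩ tᶜ).Nonempty) : ∃ z ∈ s, z ∈ frontier t := by
  by_contra! hcon
  have key : ∀ z ∈ s, z ∈ t → z ∈ interior t := fun z hz hzt => by
    by_contra hzi
    exact hcon z hz (ht.frontier_eq ▸ ⟨hzt, hzi⟩)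
  obtain ⟨z, hz, hzt⟩ := h1
  obtain ⟨y, -, hy1, hy2⟩ := hs (interior t) tᶜ isOpen_interior ht.isOpen_compl
    (fun y hy => by
      by_cases hyt : y ∈ t
      · exact Or.inl (key y hy hyt)
      · exact Or.inr hyt) ⟨z, hz, key z hz hzt⟩ h2
  exact hy2 (interior_subset hy1)

/-- The boundary of a proper subset of `E` with nonempty interior has codimension at most one. -/
theorem finrank_sub_one_le_dimH_frontier {E : Type*} [NormedAddCommGroup E]
    [InnerProductSpace ℝ E] [FiniteDimensional ℝ E] [MeasurableSpace E] [BorelSpace E]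
    {K : Set E} (hK : IsClosed K) (hint : (interior K).Nonempty) (hne : K ≠ Set.univ) :
    (finrank ℝ E : ENNReal) ≤ dimH (frontier K) + 1 := by
  obtain ⟨c, hc⟩ := hint
  obtain ⟨x, hx⟩ := (Set.ne_univ_iff_exists_notMem K).1 hne
  have hu : x - c ≠ 0 := by
    intro h
    rw [sub_eq_zero] at h
    exact hx (h ▸ interior_subset hc)
  -- Project along the direction from an interior point c to an exterior point x. Segments parallel
  -- to it and close to [c, x] all cross the boundary, so the shadow of the boundary contains an
  -- open subset of a hyperplane, and projecting does not raise dimension.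
  set W : Submodule ℝ E := (Submodule.span ℝ {x - c})ᗮ with hW
  have hfin : finrank ℝ W + 1 = finrank ℝ E := by
    have h1 := Submodule.finrank_add_finrank_orthogonal (Submodule.span ℝ {x - c})
    rw [finrank_span_singleton hu] at h1
    have h2 : finrank ℝ W = finrank ℝ (Submodule.span ℝ {x - c})ᗮ := rfl
    omega
  have hpu : W.orthogonalProjectionOnto (x - c) = 0 := by
    rw [Submodule.orthogonalProjectionOnto_eq_zero_iff, hW, Submodule.orthogonal_orthogonal]
    exact Submodule.mem_span_singleton_self _
  have hnhds : (W.orthogonalProjectionOnto '' frontier K) ∈ nhds (W.orthogonalProjectionOnto c) := by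
    have h1 : ∀ᶠ w : W in nhds 0, c + (w : E) ∈ K := by
      have : Filter.Tendsto (fun w : W => c + (w : E)) (nhds 0) (nhds c) := by
        have : Continuous (fun w : W => c + (w : E)) := by fun_prop
        simpa using this.tendsto 0
      exact this.eventually (mem_interior_iff_mem_nhds.1 hc)
    have h2 : ∀ᶠ w : W in nhds 0, x + (w : E) ∈ Kᶜ := by
      have : Filter.Tendsto (fun w : W => x + (w : E)) (nhds 0) (nhds x) := by
        have : Continuous (fun w : W => x + (w : E)) := by fun_prop
        simpa using this.tendsto 0
      exact this.eventually (hK.isOpen_compl.mem_nhds hx)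
    have h3 : Filter.Tendsto (fun w : W => w - W.orthogonalProjectionOnto c)
        (nhds (W.orthogonalProjectionOnto c)) (nhds 0) := by
      have : Continuous (fun w : W => w - W.orthogonalProjectionOnto c) := by fun_prop
      simpa using this.tendsto (W.orthogonalProjectionOnto c)
    filter_upwards [h3.eventually (h1.and h2)] with w hw
    set v : W := w - W.orthogonalProjectionOnto c with hv
    obtain ⟨hw1, hw2⟩ := hw
    obtain ⟨z, hz, hzf⟩ := (convex_segment (𝕜 := ℝ) (c + (v : E)) (x + (v : E))).isPreconnected
      |>.exists_mem_frontier_of_isClosed hK ⟨_, left_mem_segment _ _ _, hw1⟩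
        ⟨_, right_mem_segment _ _ _, hw2⟩
    refine ⟨z, hzf, ?_⟩
    rw [segment_eq_image'] at hz
    obtain ⟨t, -, rfl⟩ := hz
    have : c + (v : E) + t • (x + (v : E) - (c + (v : E))) = c + v + t • (x - c) := by
      simp
    simp only [this]
    rw [map_add, map_add, map_smul, hpu, smul_zero, add_zero,
      Submodule.orthogonalProjectionOnto_mem_subspace_eq_self, hv, add_sub_cancel]
  have h4 := Real.dimH_of_mem_nhds hnhds
  have h5 := dimH_orthogonalProjectionOnto_le (𝕜 := ℝ) W (frontier K)
  rw [← hfin, Nat.cast_add, ← h4, Nat.cast_one]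
  gcongr

/-- The boundary of a closed convex set without interior points has the dimension of the set. -/
theorem Convex.dimH_frontier_eq_finrank_vectorSpan {E : Type*} [NormedAddCommGroup E]
    [InnerProductSpace ℝ E] [FiniteDimensional ℝ E] [MeasurableSpace E] [BorelSpace E]
    {K : Set E} (hconv : Convex ℝ K) (hK : IsClosed K) (hne : K.Nonempty) (hint : interior K = ∅) :
    dimH (frontier K) = finrank ℝ (vectorSpan ℝ K) := by
  rw [hK.frontier_eq, hint, Set.sdiff_empty, Real.Convex.dimH_eq_finrank_vectorSpan hconv hne]

theorem Convex.finrank_vectorSpan_lt {E : Type*} [NormedAddCommGroup E]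
    [InnerProductSpace ℝ E] [FiniteDimensional ℝ E]
    {K : Set E} (hconv : Convex ℝ K) (hne : K.Nonempty) (hint : interior K = ∅) :
    finrank ℝ (vectorSpan ℝ K) < finrank ℝ E := by
  apply Submodule.finrank_lt
  intro h
  have : (interior K).Nonempty := by
    rw [hconv.interior_nonempty_iff_affineSpan_eq_top]
    rwa [AffineSubspace.affineSpan_eq_top_iff_vectorSpan_eq_top_of_nonempty ℝ E E hne]
  simp [hint] at this

end Dimension

/-! ### Nearest point projection and regularity of the distance. -/

/-- `P` is the nearest point projection onto `K`, characterised by its variational inequality. -/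
structure IsConvexProjection {E : Type*} [NormedAddCommGroup E] [InnerProductSpace ℝ E]
    (K : Set E) (P : E → E) : Prop where
  mem : ∀ x, P x ∈ K
  inner_le : ∀ x, ∀ w ∈ K, inner ℝ (x - P x) (w - P x) ≤ 0

theorem exists_isConvexProjection {E : Type*} [NormedAddCommGroup E] [InnerProductSpace ℝ E]
    [CompleteSpace E] {K : Set E} (hK : IsClosed K) (hconv : Convex ℝ K) (hne : K.Nonempty) :
    ∃ P : E → E, IsConvexProjection K P := by
  have h := exists_norm_eq_iInf_of_complete_convex hne hK.isComplete hconv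
  choose P hP hP' using h
  exact ⟨P, hP, fun x => (norm_eq_iInf_iff_real_inner_le_zero hconv (hP x)).1 (hP' x)⟩

namespace IsConvexProjection

variable {E : Type*} [NormedAddCommGroup E] [InnerProductSpace ℝ E] {K : Set E} {P : E → E}

theorem norm_sub_le (h : IsConvexProjection K P) (x : E) {w : E} (hw : w ∈ K) :
    ‖x - P x‖ ≤ ‖x - w‖ := by
  have h1 := h.inner_le x w hw
  have h2 : x - w = (x - P x) - (w - P x) := by abel
  have h3 := norm_sub_sq_real (x - P x) (w - P x)
  rw [← h2] at h3
  refine le_of_sq_le_sq ?_ (norm_nonneg _)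
  nlinarith [sq_nonneg ‖w - P x‖]

theorem infDist_eq (h : IsConvexProjection K P) (x : E) : Metric.infDist x K = ‖x - P x‖ := by
  apply le_antisymm
  · rw [← dist_eq_norm]
    exact Metric.infDist_le_dist_of_mem (h.mem x)
  · rw [Metric.le_infDist ⟨_, h.mem x⟩]
    intro y hy
    rw [dist_eq_norm]
    exact h.norm_sub_le x hy

theorem sub_ne_zero (h : IsConvexProjection K P) {x : E} (hx : x ∈ Kᶜ) : x - P x ≠ 0 := by
  intro h0
  rw [_root_.sub_eq_zero] at h0
  exact hx (h0 ▸ h.mem x)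

theorem norm_pos (h : IsConvexProjection K P) {x : E} (hx : x ∈ Kᶜ) : 0 < ‖x - P x‖ :=
  norm_pos_iff.2 (h.sub_ne_zero hx)

theorem sub_eq_zero (h : IsConvexProjection K P) {x : E} (hx : x ∈ K) : x - P x = 0 := by
  have := h.norm_sub_le x hx
  simpa using this

/-- Firm nonexpansiveness of the projection. -/
theorem norm_sq_le_inner (h : IsConvexProjection K P) (x y : E) :
    ‖P y - P x‖ ^ 2 ≤ inner ℝ (P y - P x) (y - x) := by
  have h1 := h.inner_le x _ (h.mem y)
  have h2 := h.inner_le y _ (h.mem x)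
  have h3 : inner ℝ (P y - P x) (y - x) - ‖P y - P x‖ ^ 2
      = - inner ℝ (x - P x) (P y - P x) - inner ℝ (y - P y) (P x - P y) := by
    rw [← real_inner_self_eq_norm_sq, ← neg_sub (P y) (P x), inner_neg_right, sub_neg_eq_add,
      ← inner_sub_right, ← inner_neg_left, ← inner_add_left, real_inner_comm]
    congr 1
    abel
  linarith

theorem inner_le_norm_sq (h : IsConvexProjection K P) (x y : E) :
    inner ℝ (P y - P x) (y - x) ≤ ‖y - x‖ ^ 2 := by
  have h1 := h.norm_sq_le_inner x y
  have h2 := real_inner_le_norm (P y - P x) (y - x)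
  have h3 : ‖P y - P x‖ ≤ ‖y - x‖ := by
    by_contra! hlt
    nlinarith [norm_nonneg (y - x), norm_nonneg (P y - P x)]
  nlinarith [norm_nonneg (y - x), norm_nonneg (P y - P x)]

theorem lipschitzWith (h : IsConvexProjection K P) : LipschitzWith 1 P := by
  refine LipschitzWith.of_dist_le_mul fun x y => ?_
  rw [dist_eq_norm, dist_eq_norm, NNReal.coe_one, one_mul]
  have h1 := h.norm_sq_le_inner y x
  have h2 := real_inner_le_norm (P x - P y) (x - y)
  by_contra! hlt
  nlinarith [norm_nonneg (x - y), norm_nonneg (P x - P y)]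

theorem continuous_sub (h : IsConvexProjection K P) : Continuous fun x => x - P x :=
  continuous_id.sub h.lipschitzWith.continuous

/-- Monotonicity of `x ↦ x - P x`. -/
theorem inner_sub_sub_nonneg (h : IsConvexProjection K P) (x y : E) :
    0 ≤ inner ℝ ((y - P y) - (x - P x)) (y - x) := by
  have h1 := h.inner_le_norm_sq x y
  have h2 : (y - P y) - (x - P x) = (y - x) - (P y - P x) := by abel
  rw [h2, inner_sub_left, real_inner_self_eq_norm_sq]
  linarith

/-- The unit vector field `(x - P x) / ‖x - P x‖` consists of subgradients of the distance. -/
theorem inner_normalized_le (h : IsConvexProjection K P) (x y : E) :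
    inner ℝ (‖x - P x‖⁻¹ • (x - P x)) (y - x) ≤ ‖y - P y‖ - ‖x - P x‖ := by
  by_cases h0 : x - P x = 0
  · simp [h0]
  have hn : 0 < ‖x - P x‖ := norm_pos_iff.2 h0
  have h1 := h.inner_le x _ (h.mem y)
  have h2 := real_inner_le_norm (x - P x) (y - P y)
  have h3 : y - x = (y - P y) + (P y - P x) - (x - P x) := by abel
  have h4 : inner ℝ (x - P x) (y - x) ≤ ‖x - P x‖ * (‖y - P y‖ - ‖x - P x‖) := by
    rw [h3, inner_sub_right, inner_add_right, real_inner_self_eq_norm_sq]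
    nlinarith
  rw [real_inner_smul_left, inv_mul_le_iff₀ hn]
  exact h4

/-- Subgradients of a convex function are monotone: add the two subgradient inequalities. -/
theorem inner_normalized_sub_nonneg (h : IsConvexProjection K P) (x y : E) :
    0 ≤ inner ℝ (‖y - P y‖⁻¹ • (y - P y) - ‖x - P x‖⁻¹ • (x - P x)) (y - x) := by
  have h1 := h.inner_normalized_le x y
  have h2 := h.inner_normalized_le y x
  rw [← neg_sub y x, inner_neg_right] at h2
  rw [inner_sub_left]
  linarith

/-- Half the squared distance has gradient `x - P x`. -/
theorem hasFDerivAt_half_norm_sq (h : IsConvexProjection K P) (x : E) :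
    HasFDerivAt (fun y => ‖y - P y‖ ^ 2 / 2) (innerSL ℝ (x - P x)) x := by
  refine HasFDerivAt.of_isLittleO ?_
  -- Quadratic error from both sides: P x is a competitor for y (upper bound) and P y one for x; in
  -- the latter, monotonicity replaces F(y) by F(x).
  have hb : ∀ y, ‖‖y - P y‖ ^ 2 / 2 - ‖x - P x‖ ^ 2 / 2 - innerSL ℝ (x - P x) (y - x)‖
      ≤ 1 * ‖‖y - x‖ ^ 2‖ := by
    intro y
    rw [innerSL_apply_apply, one_mul, Real.norm_eq_abs, Real.norm_of_nonneg (sq_nonneg _), abs_le]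
    have h1 := h.norm_sub_le y (h.mem x)
    have h2 := h.norm_sub_le x (h.mem y)
    have h3 : ‖y - P x‖ ^ 2 = ‖x - P x‖ ^ 2 + 2 * inner ℝ (x - P x) (y - x) + ‖y - x‖ ^ 2 := by
      rw [← norm_add_sq_real]; congr 2; abel
    have h4 : ‖x - P y‖ ^ 2 = ‖y - P y‖ ^ 2 - 2 * inner ℝ (y - P y) (y - x) + ‖y - x‖ ^ 2 := by
      rw [← norm_sub_sq_real]; congr 2; abel
    have h5 := h.inner_sub_sub_nonneg x y
    rw [inner_sub_left] at h5
    have h6 : ‖y - P y‖ ^ 2 ≤ ‖y - P x‖ ^ 2 := by gcongr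
    have h7 : ‖x - P x‖ ^ 2 ≤ ‖x - P y‖ ^ 2 := by gcongr
    constructor <;> nlinarith [sq_nonneg ‖y - x‖]
  refine (Asymptotics.IsBigO.of_bound 1 (Filter.Eventually.of_forall hb)).trans_isLittleO ?_
  have ht : Filter.Tendsto (fun y => y - x) (nhds x) (nhds 0) := by
    simpa using (show Continuous fun y : E => y - x by fun_prop).tendsto x
  exact (Asymptotics.isLittleO_norm_pow_id one_lt_two).comp_tendsto ht

theorem contDiff_half_norm_sq (h : IsConvexProjection K P) :
    ContDiff ℝ 1 fun y => ‖y - P y‖ ^ 2 / 2 := by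
  rw [contDiff_one_iff_fderiv]
  refine ⟨fun x => (h.hasFDerivAt_half_norm_sq x).differentiableAt, ?_⟩
  have : fderiv ℝ (fun y => ‖y - P y‖ ^ 2 / 2) = fun x => innerSL ℝ (x - P x) :=
    funext fun x => (h.hasFDerivAt_half_norm_sq x).fderiv
  rw [this]
  exact (innerSL ℝ).continuous.comp h.continuous_sub

theorem contDiffAt_norm (h : IsConvexProjection K P) {x : E} (hx : x ∈ Kᶜ) :
    ContDiffAt ℝ 1 (fun y => ‖y - P y‖) x := by
  have h1 : (fun y => ‖y - P y‖) = fun y => Real.sqrt (2 * (‖y - P y‖ ^ 2 / 2)) := by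
    funext y
    rw [mul_div_cancel₀ _ two_ne_zero, Real.sqrt_sq (norm_nonneg _)]
  have := h.norm_pos hx
  rw [h1]
  exact (contDiffAt_const.mul h.contDiff_half_norm_sq.contDiffAt).sqrt (by positivity)

theorem hasFDerivAt_norm (h : IsConvexProjection K P) {x : E} (hx : x ∈ Kᶜ) :
    HasFDerivAt (fun y => ‖y - P y‖) (‖x - P x‖⁻¹ • innerSL ℝ (x - P x)) x := by
  have hd := ((h.contDiffAt_norm hx).differentiableAt one_ne_zero).hasFDerivAt
  have h1 := (hd.pow 2).mul_const (2⁻¹ : ℝ)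
  have h2 := h1.unique (by simpa only [div_eq_mul_inv] using h.hasFDerivAt_half_norm_sq x)
  have := h.norm_pos hx
  have h3 : ‖x - P x‖⁻¹ • innerSL ℝ (x - P x) = fderiv ℝ (fun y => ‖y - P y‖) x := by
    rw [← h2]
    ext v
    simp
    field_simp
  rwa [h3]

end IsConvexProjection

theorem contDiff_of_contDiffAt_of_mem_tsupport {E F : Type*} [NormedAddCommGroup E]
    [NormedSpace ℝ E] [NormedAddCommGroup F] [NormedSpace ℝ F] {n : WithTop ℕ∞} {f : E → F}
    (hf : ∀ x ∈ tsupport f, ContDiffAt ℝ n f x) : ContDiff ℝ n f := by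
  rw [contDiff_iff_contDiffAt]
  intro x
  by_cases hx : x ∈ tsupport f
  · exact hf x hx
  · exact contDiffAt_const.congr_of_eventuallyEq (notMem_tsupport_iff_eventuallyEq.1 hx)

theorem IsConvexProjection.contDiff_norm_mul {E : Type*} [NormedAddCommGroup E]
    [InnerProductSpace ℝ E] {K : Set E} {P : E → E} (h : IsConvexProjection K P) {g : E → ℝ}
    (hg : ContDiff ℝ 1 g) (hgK : tsupport g ⊆ Kᶜ) :
    ContDiff ℝ 1 fun x => ‖x - P x‖ * g x := by
  refine contDiff_of_contDiffAt_of_mem_tsupport fun x hx => ?_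
  exact (h.contDiffAt_norm (hgK (tsupport_mul_subset_right hx))).mul hg.contDiffAt

/-! ### Weak divergence of monotone vector fields. -/

section WeakDivergence

open Module

variable {E : Type*} [NormedAddCommGroup E] [InnerProductSpace ℝ E] [FiniteDimensional ℝ E]
  [MeasurableSpace E] [BorelSpace E]

/-- A weak lower bound for a directional derivative, from a lower bound for the increments. -/
theorem integral_fderiv_mul_le_of_increment_ge {f g : E → ℝ} {b : E} {l : ℝ}
    (hf : LocallyIntegrable f) (hinc : ∀ x, ∀ t : ℝ, 0 < t → l * t ≤ f (x + t • b) - f x)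
    (hg : ContDiff ℝ 1 g) (hgc : HasCompactSupport g) (hg0 : ∀ x, 0 ≤ g x) :
    ∫ x, fderiv ℝ g x b * f x ≤ -(l * ∫ x, g x) := by
  obtain ⟨R, hR⟩ := hgc.isCompact.isBounded.subset_closedBall (0 : E)
  -- Truncating makes f integrable; the margin ‖b‖ keeps x + t • b in the ball for x in the support
  -- of g and 0 < t < 1.
  set B := Metric.closedBall (0 : E) (R + ‖b‖) with hB
  set f₁ := B.indicator f with hf₁
  have hf₁i : Integrable f₁ :=
    (hf.integrableOn_isCompact (isCompact_closedBall _ _)).integrable_indicator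
      measurableSet_closedBall
  obtain ⟨C, hC⟩ := hg.lipschitzWith_of_hasCompactSupport hgc one_ne_zero
  -- Difference quotients of g along -b become, by translation, those of f along b, where the
  -- increment bound applies.
  have hlim := hC.integral_inv_smul_sub_mul_tendsto_integral_lineDeriv_mul hf₁i (-b)
  have hgf : ∀ {u : E → ℝ}, Integrable u → Integrable fun x => g x * u x := by
    intro u hu
    obtain ⟨M, hM⟩ := hgc.exists_bound_of_continuous hg.continuous
    exact hu.bdd_mul hg.continuous.aestronglyMeasurable (Filter.Eventually.of_forall hM)
  have hge : l * ∫ x, g x ≤ ∫ x, lineDeriv ℝ g x (-b) * f₁ x := by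
    refine ge_of_tendsto hlim ?_
    filter_upwards [Ioo_mem_nhdsGT (zero_lt_one : (0 : ℝ) < 1)] with t ht
    have h1 : ∫ x, (t⁻¹ • (g (x + t • -b) - g x)) * f₁ x
        = ∫ x, t⁻¹ * (g x * f₁ (x + t • b) - g x * f₁ x) := by
      have e1 : ∫ x, g (x + t • -b) * f₁ x = ∫ x, g x * f₁ (x + t • b) := by
        rw [← integral_add_right_eq_self _ (t • b)]
        simp
      have i1 : Integrable fun x => g x * f₁ (x + t • b) := hgf (hf₁i.comp_add_right _)
      have i2 : Integrable fun x => g (x + t • -b) * f₁ x := by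
        have := i1.comp_add_right (t • -b)
        simpa using this
      simp only [smul_eq_mul, mul_assoc, sub_mul]
      rw [integral_const_mul, integral_const_mul, integral_sub i2 (hgf hf₁i),
        integral_sub i1 (hgf hf₁i), e1]
    rw [h1, ← integral_const_mul]
    refine integral_mono ((hg.continuous.integrable_of_hasCompactSupport hgc).const_mul l)
      (((hgf (hf₁i.comp_add_right _)).sub (hgf hf₁i)).const_mul _) fun x => ?_
    by_cases hx : g x = 0
    · simp [hx]
    have hxR : ‖x‖ ≤ R := by
      simpa using hR (subset_tsupport _ (Function.mem_support.2 hx))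
    have hx1 : x ∈ B := by
      simp only [hB, mem_closedBall_zero_iff]
      linarith [norm_nonneg b]
    have hx2 : x + t • b ∈ B := by
      simp only [hB, mem_closedBall_zero_iff]
      refine (norm_add_le _ _).trans ?_
      rw [norm_smul, Real.norm_of_nonneg ht.1.le]
      nlinarith [norm_nonneg b, ht.2]
    simp only [hf₁, Set.indicator_of_mem hx1, Set.indicator_of_mem hx2]
    rw [← mul_sub, mul_left_comm, mul_comm l]
    refine mul_le_mul_of_nonneg_left ?_ (hg0 x)
    rw [le_inv_mul_iff₀ ht.1, mul_comm]
    exact hinc x t ht.1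
  have heq : ∀ x, lineDeriv ℝ g x (-b) * f₁ x = -(fderiv ℝ g x b * f x) := by
    intro x
    rw [(hg.differentiable one_ne_zero x).lineDeriv_eq_fderiv, map_neg]
    by_cases hx : x ∈ tsupport g
    · have hx1 : x ∈ B := by
        have := hR hx
        simp only [hB, mem_closedBall_zero_iff] at this ⊢
        linarith [norm_nonneg b]
      simp [hf₁, hx1]
    · have : fderiv ℝ g x = 0 := by
        by_contra h
        exact hx (support_fderiv_subset ℝ h)
      simp [this]
  simp only [heq, integral_neg] at hge
  linarith

/-- The weak divergence of a monotone vector field is bounded below by the dimension of any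
subspace along which the field is strongly monotone. -/
theorem integral_fderiv_apply_le_of_monotone {F : E → E} (hF : LocallyIntegrable F)
    (hmono : ∀ x y, 0 ≤ inner ℝ (F y - F x) (y - x)) (W : Submodule ℝ E)
    (hW : ∀ x, ∀ w ∈ W, ‖w‖ ^ 2 ≤ inner ℝ (F (x + w) - F x) w)
    {g : E → ℝ} (hg : ContDiff ℝ 1 g) (hgc : HasCompactSupport g) (hg0 : ∀ x, 0 ≤ g x) :
    ∫ x, fderiv ℝ g x (F x) ≤ -(finrank ℝ W * ∫ x, g x) := by
  have hcomp : ∀ b : E, LocallyIntegrable fun x => inner ℝ b (F x) := by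
    intro b x
    obtain ⟨s, hs, hs'⟩ := hF x
    exact ⟨s, hs, (innerSL ℝ b).integrable_comp hs'⟩
  -- In an orthonormal basis adapted to W ⊕ Wᗮ, each direction in W contributes at least 1 to the
  -- divergence and each direction in Wᗮ at least 0.
  set u := stdOrthonormalBasis ℝ W
  set v := stdOrthonormalBasis ℝ Wᗮ
  have hdec : ∀ y : E, y = ∑ i, inner ℝ (u i : E) y • (u i : E)
      + ∑ i, inner ℝ (v i : E) y • (v i : E) := by
    intro y
    have h1 : W.starProjection y + Wᗮ.starProjection y = y :=
      Submodule.starProjection_add_starProjection_orthogonal (K := W) y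
    rw [Submodule.starProjection_apply, Submodule.starProjection_apply,
      u.orthogonalProjectionOnto_apply_eq_sum, v.orthogonalProjectionOnto_apply_eq_sum] at h1
    simpa using h1.symm
  have hint : ∀ b : E, Integrable fun x => fderiv ℝ g x b * inner ℝ b (F x) := by
    intro b
    have hc : Continuous fun x => fderiv ℝ g x b :=
      (hg.continuous_fderiv one_ne_zero).clm_apply continuous_const
    exact (hcomp b).integrable_smul_left_of_hasCompactSupport hc (hgc.fderiv_apply ℝ b)
  have hsum : ∀ x, fderiv ℝ g x (F x) = ∑ i, fderiv ℝ g x (u i) * inner ℝ (u i : E) (F x)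
      + ∑ i, fderiv ℝ g x (v i) * inner ℝ (v i : E) (F x) := by
    intro x
    conv_lhs => rw [hdec (F x)]
    simp [map_add, map_sum, mul_comm]
  simp only [hsum]
  rw [integral_add (integrable_finsetSum _ fun i _ => hint _)
    (integrable_finsetSum _ fun i _ => hint _), integral_finsetSum _ fun i _ => hint _,
    integral_finsetSum _ fun i _ => hint _]
  have h1 : ∀ i, ∫ x, fderiv ℝ g x (u i) * inner ℝ (u i : E) (F x) ≤ -(1 * ∫ x, g x) := by
    intro i
    refine integral_fderiv_mul_le_of_increment_ge (hcomp _) (fun x t ht => ?_) hg hgc hg0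
    have h2 := hW x (t • (u i : E)) (W.smul_mem t (u i).2)
    have h3 : ‖(u i : E)‖ = 1 := by
      rw [← Submodule.coe_norm]; exact u.orthonormal.1 i
    rw [norm_smul, h3, Real.norm_of_nonneg ht.le, inner_smul_right, inner_sub_left,
      real_inner_comm, real_inner_comm _ (F x)] at h2
    nlinarith
  have h2 : ∀ i, ∫ x, fderiv ℝ g x (v i) * inner ℝ (v i : E) (F x) ≤ -(0 * ∫ x, g x) := by
    intro i
    refine integral_fderiv_mul_le_of_increment_ge (hcomp _) (fun x t ht => ?_) hg hgc hg0
    have h2 := hmono x (x + t • (v i : E))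
    rw [add_sub_cancel_left, inner_smul_right, inner_sub_left,
      real_inner_comm, real_inner_comm _ (F x)] at h2
    nlinarith
  have h3 := Finset.sum_le_sum fun i (_ : i ∈ Finset.univ) => h1 i
  have h4 := Finset.sum_le_sum fun i (_ : i ∈ Finset.univ) => h2 i
  simp only [Finset.sum_const, Finset.card_univ, Fintype.card_fin, nsmul_eq_mul] at h3 h4
  linarith

namespace IsConvexProjection

variable {K : Set E} {P : E → E}

/-- Differences of values of P lie in the direction space of K, so a displacement w normal to it
gives ⟨F(x + w) - F(x), w⟩ = ‖w‖². -/
theorem integral_fderiv_apply_sub_le (h : IsConvexProjection K P) {g : E → ℝ}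
    (hg : ContDiff ℝ 1 g) (hgc : HasCompactSupport g) (hg0 : ∀ x, 0 ≤ g x) :
    ∫ x, fderiv ℝ g x (x - P x) ≤ -(finrank ℝ (vectorSpan ℝ K)ᗮ * ∫ x, g x) := by
  refine integral_fderiv_apply_le_of_monotone h.continuous_sub.locallyIntegrable
    h.inner_sub_sub_nonneg _ (fun x w hw => ?_) hg hgc hg0
  have h1 : inner ℝ (P (x + w) - P x) w = 0 :=
    Submodule.inner_right_of_mem_orthogonal
      (vsub_mem_vectorSpan ℝ (h.mem (x + w)) (h.mem x)) hw
  have h2 : (x + w - P (x + w)) - (x - P x) = w - (P (x + w) - P x) := by abel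
  rw [h2, inner_sub_left, h1, real_inner_self_eq_norm_sq, sub_zero]

/-- The normalized field N = ∇D is monotone, so its weak divergence is nonnegative. Testing this on
D g yields the bound, because ∇(D g)·N = ∇g·F + g off K. This covers convex sets with interior,
where the codimension of the direction space is 0. -/
theorem integral_fderiv_apply_sub_le_neg_integral (h : IsConvexProjection K P) {g : E → ℝ}
    (hg : ContDiff ℝ 1 g) (hgc : HasCompactSupport g) (hgK : tsupport g ⊆ Kᶜ)
    (hg0 : ∀ x, 0 ≤ g x) :
    ∫ x, fderiv ℝ g x (x - P x) ≤ -∫ x, g x := by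
  have hmeas : Measurable fun x => ‖x - P x‖⁻¹ • (x - P x) :=
    h.continuous_sub.measurable.norm.inv.smul h.continuous_sub.measurable
  have hloc : LocallyIntegrable fun x => ‖x - P x‖⁻¹ • (x - P x) := by
    refine (locallyIntegrable_const (1 : ℝ)).mono hmeas.aestronglyMeasurable
      (Filter.Eventually.of_forall fun x => ?_)
    rw [norm_smul, norm_inv, norm_norm, norm_one]
    exact inv_mul_le_one
  have h1 := integral_fderiv_apply_le_of_monotone hloc h.inner_normalized_sub_nonneg ⊥
    (fun x w hw => by simp [(Submodule.mem_bot ℝ).1 hw]) (h.contDiff_norm_mul hg hgK)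
    hgc.mul_left (fun x => mul_nonneg (norm_nonneg _) (hg0 x))
  have h2 : ∀ x, fderiv ℝ (fun y => ‖y - P y‖ * g y) x (‖x - P x‖⁻¹ • (x - P x))
      = fderiv ℝ g x (x - P x) + g x := by
    intro x
    by_cases hx : x ∈ Kᶜ
    · have hn := h.norm_pos hx
      have h3 : HasFDerivAt (fun y => ‖y - P y‖ * g y) _ x :=
        (h.hasFDerivAt_norm hx).mul (hg.differentiable one_ne_zero x).hasFDerivAt
      have h4 := real_inner_self_eq_norm_sq (x - P x)
      rw [h3.fderiv]
      simp only [add_apply, smul_apply, map_smul, smul_eq_mul, innerSL_apply_apply, h4]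
      field_simp
    · have h0 : g =ᶠ[nhds x] 0 := notMem_tsupport_iff_eventuallyEq.1 fun hx' => hx (hgK hx')
      have h3 : x - P x = 0 := h.sub_eq_zero (not_not.1 hx)
      simp [h3, h0.eq_of_nhds]
  simp only [h2, finrank_bot, Nat.cast_zero, zero_mul, neg_zero] at h1
  rw [integral_add] at h1
  · linarith
  · refine Continuous.integrable_of_hasCompactSupport
      ((hg.continuous_fderiv one_ne_zero).clm_apply h.continuous_sub) ?_
    exact (hgc.fderiv ℝ).mono fun x hx hx0 => hx (by simp [hx0])
  · exact hg.continuous.integrable_of_hasCompactSupport hgc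

end IsConvexProjection

end WeakDivergence

/-! ### Comparison of the weak divergence with the codimension of the boundary. -/

section Codimension

open Module

/-- The vector field `x - P x` has weak divergence at least the codimension of the boundary. -/
theorem IsConvexProjection.exists_codim_le_weakDiv {d : ℕ} {K : Set (EuclideanSpace ℝ (Fin d))}
    {P : EuclideanSpace ℝ (Fin d) → EuclideanSpace ℝ (Fin d)} (h : IsConvexProjection K P)
    (hK : IsClosed K) (hconv : Convex ℝ K) (hne : K.Nonempty) (huniv : K ≠ Set.univ) :
    ∃ m : ℝ, 1 ≤ m ∧ (d : ℝ) - boundaryDim Kᶜ ≤ m ∧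
      ∀ g : EuclideanSpace ℝ (Fin d) → ℝ, ContDiff ℝ 1 g → HasCompactSupport g →
        tsupport g ⊆ Kᶜ → (∀ x, 0 ≤ g x) →
          ∫ x, fderiv ℝ g x (x - P x) ≤ -(m * ∫ x, g x) := by
  have hfin : dimH (frontier K) ≠ ⊤ := Real.dimH_ne_top _
  have hd : finrank ℝ (EuclideanSpace ℝ (Fin d)) = d := finrank_euclideanSpace_fin
  by_cases hint : interior K = ∅
  · have h1 := hconv.finrank_vectorSpan_lt hne hint
    have h2 := Submodule.finrank_add_finrank_orthogonal (vectorSpan ℝ K)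
    have h3 := hconv.dimH_frontier_eq_finrank_vectorSpan hK hne hint
    rw [hd] at h1 h2
    refine ⟨finrank ℝ (vectorSpan ℝ K)ᗮ, ?_, ?_, fun g hg hgc _ hg0 =>
      h.integral_fderiv_apply_sub_le hg hgc hg0⟩
    · have : 1 ≤ finrank ℝ (vectorSpan ℝ K)ᗮ := by omega
      exact_mod_cast this
    · rw [boundaryDim, frontier_compl, h3, ENNReal.toReal_natCast, sub_le_iff_le_add, add_comm]
      exact_mod_cast h2.ge
  · have h1 := finrank_sub_one_le_dimH_frontier hK (Set.nonempty_iff_ne_empty.2 hint) huniv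
    refine ⟨1, le_rfl, ?_, fun g hg hgc hgK hg0 => ?_⟩
    · have h2 := ENNReal.toReal_mono (by simpa using hfin) h1
      rw [ENNReal.toReal_add hfin ENNReal.one_ne_top, hd] at h2
      simp only [ENNReal.toReal_natCast, ENNReal.toReal_one] at h2
      rw [boundaryDim, frontier_compl]
      linarith
    · rw [one_mul]
      exact h.integral_fderiv_apply_sub_le_neg_integral hg hgc hgK hg0

end Codimension

/-! ### One-variable calculus of the weight and the scalar inequality. -/

section Profile

/-- The logarithmic derivative `s c'(s) / c(s)` of the profile `c = weightProfile δ δ'`. -/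
noncomputable def profileExponent (δ δ' s : ℝ) : ℝ := δ + (δ' - δ) * (s / (1 + s))

theorem contDiffAt_weightProfile (δ δ' : ℝ) {s : ℝ} (hs : 0 < s) :
    ContDiffAt ℝ 1 (weightProfile δ δ') s := by
  unfold weightProfile
  exact (contDiffAt_id.rpow_const_of_ne hs.ne').mul
    ((contDiffAt_const.add contDiffAt_id).rpow_const_of_ne (by positivity))

theorem hasDerivAt_weightProfile (δ δ' : ℝ) {s : ℝ} (hs : 0 < s) :
    HasDerivAt (weightProfile δ δ')
      (weightProfile δ δ' s * profileExponent δ δ' s / s) s := by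
  have h1 : 0 < 1 + s := by positivity
  have h2 := ((hasDerivAt_id s).rpow_const (p := δ) (Or.inl hs.ne')).mul
    (((hasDerivAt_id s).const_add 1).rpow_const (p := δ' - δ) (Or.inl h1.ne'))
  unfold weightProfile
  refine HasDerivAt.congr_deriv h2 ?_
  simp only [id_eq, Real.rpow_sub_one hs.ne', Real.rpow_sub_one h1.ne', profileExponent]
  field_simp

theorem contDiffAt_profileExponent (δ δ' : ℝ) {s : ℝ} (hs : 0 < s) :
    ContDiffAt ℝ 1 (profileExponent δ δ') s := by
  unfold profileExponent
  exact contDiffAt_const.add (contDiffAt_const.mul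
    (contDiffAt_id.div (contDiffAt_const.add contDiffAt_id) (by positivity)))

theorem hasDerivAt_profileExponent (δ δ' : ℝ) {s : ℝ} (hs : 0 < s) :
    HasDerivAt (profileExponent δ δ') ((δ' - δ) / (1 + s) ^ 2) s := by
  have h1 : 1 + s ≠ 0 := by positivity
  have h2 := (((hasDerivAt_id s).div ((hasDerivAt_id s).const_add 1) h1).const_mul
    (δ' - δ)).const_add δ
  unfold profileExponent
  refine HasDerivAt.congr_deriv h2 ?_
  simp only [id_eq]
  ring

/-- The radial multiplier `W(s) = c(s) / s²`. -/
noncomputable def rellichMultiplier (δ δ' s : ℝ) : ℝ := weightProfile δ δ' s / s ^ 2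

theorem contDiffAt_rellichMultiplier (δ δ' : ℝ) {s : ℝ} (hs : 0 < s) :
    ContDiffAt ℝ 1 (rellichMultiplier δ δ') s :=
  (contDiffAt_weightProfile δ δ' hs).div (contDiffAt_id.pow 2) (by simpa using hs.ne')

theorem hasDerivAt_rellichMultiplier (δ δ' : ℝ) {s : ℝ} (hs : 0 < s) :
    HasDerivAt (rellichMultiplier δ δ')
      (rellichMultiplier δ δ' s * (profileExponent δ δ' s - 2) / s) s := by
  have h := (hasDerivAt_weightProfile δ δ' hs).div ((hasDerivAt_id s).pow 2)
    (by simpa using hs.ne')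
  unfold rellichMultiplier
  refine HasDerivAt.congr_deriv h ?_
  simp only [id_eq, Pi.pow_apply, Nat.cast_ofNat, Nat.add_one_sub_one, pow_one]
  field_simp

/-- The radial density `W(s)² (α + (2 - e(s)) / 2)` tested against the weak divergence. -/
noncomputable def rellichDensity (α δ δ' s : ℝ) : ℝ :=
  rellichMultiplier δ δ' s ^ 2 * (α + (2 - profileExponent δ δ' s) / 2)

theorem contDiffAt_rellichDensity (α δ δ' : ℝ) {s : ℝ} (hs : 0 < s) :
    ContDiffAt ℝ 1 (rellichDensity α δ δ') s :=
  ((contDiffAt_rellichMultiplier δ δ' hs).pow 2).mul (contDiffAt_const.add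
    ((contDiffAt_const.sub (contDiffAt_profileExponent δ δ' hs)).div_const 2))

theorem hasDerivAt_rellichDensity (α δ δ' : ℝ) {s : ℝ} (hs : 0 < s) :
    HasDerivAt (rellichDensity α δ δ')
      (rellichMultiplier δ δ' s ^ 2 / s *
        (2 * (profileExponent δ δ' s - 2) * (α + (2 - profileExponent δ δ' s) / 2)
          - (δ' - δ) * s / (1 + s) ^ 2 / 2)) s := by
  have h := ((hasDerivAt_rellichMultiplier δ δ' hs).pow 2).mul
    ((((hasDerivAt_profileExponent δ δ' hs).const_sub 2).div_const 2).const_add α)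
  unfold rellichDensity
  refine HasDerivAt.congr_deriv h ?_
  have h1 : 1 + s ≠ 0 := by positivity
  simp only [Pi.pow_apply, Nat.cast_ofNat]
  field_simp
  ring

theorem profileExponent_lt_two {δ δ' s : ℝ} (hδ : δ < 2) (hδ' : δ' < 2) (hs : 0 < s) :
    profileExponent δ δ' s < 2 := by
  have h1 : 0 < s / (1 + s) := by positivity
  have h2 : s / (1 + s) < 1 := by rw [div_lt_one (by positivity)]; linarith
  unfold profileExponent
  nlinarith

/-- The scalar inequality behind the Rellich constant. -/
theorem rellich_scalar_inequality {δ δ' m s : ℝ} (hδ : δ < 2) (hδ' : δ' < 2) (hm : 1 ≤ m)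
    (hpos : 0 < m + 2 * min δ δ' - 4) (hs : 0 < s) :
    m * (m + 2 * min δ δ' - 4) / 4 + ((m + 2 * min δ δ' - 4) / 2) ^ 2 ≤
      (m + 2 * (profileExponent δ δ' s - 2)) *
        ((m + 2 * min δ δ' - 4) / 2 + (2 - profileExponent δ δ' s) / 2)
        - (δ' - δ) * s / (1 + s) ^ 2 / 2 := by
  have h1 : 0 < 1 + s := by positivity
  obtain ⟨t, ht⟩ : ∃ t, t = s / (1 + s) := ⟨_, rfl⟩
  have ht0 : 0 < t := by rw [ht]; positivity
  have ht1 : t < 1 := by rw [ht, div_lt_one h1]; linarith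
  have hq : (δ' - δ) * s / (1 + s) ^ 2 = (δ' - δ) * (t * (1 - t)) := by
    rw [ht]; field_simp; ring
  rw [hq, profileExponent, ← ht]
  -- Write e = min δ δ' + y and μ = m + 2 min δ δ' - 4. The right side minus the left is y(μ/2 + 2 -
  -- min δ δ' - y) minus the term from e', and vanishes for constant e.
  rcases le_total δ δ' with h | h
  · rw [min_eq_left h] at hpos ⊢
    obtain ⟨r, hr⟩ : ∃ r, r = δ' - δ := ⟨_, rfl⟩
    have hr0 : 0 ≤ r := by linarith
    have key : 0 ≤ (m + 2 * δ - 4) / 2 + (2 - δ - r * t) - (1 - t) / 2 := by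
      have h3 : (2 - δ) * (1 - t) ≤ 2 - δ - r * t := by nlinarith
      -- For δ ≤ 3/2 the factor 2 - δ is at least 1/2 and absorbs (1 - t)/2. For larger δ, m ≥ 1
      -- gives μ/2 ≥ δ - 3/2, which covers the deficit.
      rcases le_total δ (3 / 2) with h4 | h4
      · nlinarith
      · nlinarith
    have := mul_nonneg (mul_nonneg hr0 ht0.le) key
    rw [← hr]
    nlinarith
  · rw [min_eq_right h] at hpos ⊢
    obtain ⟨r, hr⟩ : ∃ r, r = δ - δ' := ⟨_, rfl⟩
    have hr0 : 0 ≤ r := by linarith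
    obtain ⟨u, hu⟩ : ∃ u, u = 1 - t := ⟨_, rfl⟩
    have hu0 : 0 < u := by linarith
    have e1 : δ' - δ = -r := by linarith
    have e2 : t = 1 - u := by linarith
    have e3 : δ = δ' + r := by linarith
    -- Here e is nonincreasing, so the term from e' has a favourable sign (`h6`).
    have key : 0 ≤ (m + 2 * δ' - 4) / 2 + (2 - δ' - r * u) := by nlinarith
    have h5 := mul_nonneg (mul_nonneg hr0 hu0.le) key
    have h6 := mul_nonneg hr0 (mul_nonneg hu0.le ht0.le)
    rw [e1, e2, e3] at *
    nlinarith

end Profile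

/-! ### Green's formula for the divergence form operator. -/

section DivergenceForm

variable {d : ℕ}

theorem fderiv_apply_eq_sum_partialDeriv (f : EuclideanSpace ℝ (Fin d) → ℝ)
    (x v : EuclideanSpace ℝ (Fin d)) : fderiv ℝ f x v = ∑ k, partialDeriv k f x * v k := by
  have h : v = ∑ k, v k • EuclideanSpace.single k (1 : ℝ) := by
    simpa using ((EuclideanSpace.basisFun (Fin d) ℝ).sum_repr v).symm
  conv_lhs => rw [h]
  simp [map_sum, partialDeriv, mul_comm]

theorem continuous_partialDeriv {f : EuclideanSpace ℝ (Fin d) → ℝ} (hf : ContDiff ℝ 1 f)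
    (k : Fin d) : Continuous (partialDeriv k f) :=
  (hf.continuous_fderiv one_ne_zero).clm_apply continuous_const

theorem HasCompactSupport.partialDeriv {f : EuclideanSpace ℝ (Fin d) → ℝ}
    (hf : HasCompactSupport f) (k : Fin d) : HasCompactSupport (partialDeriv k f) :=
  hf.fderiv_apply ℝ _

theorem tsupport_partialDeriv_subset (k : Fin d) (f : EuclideanSpace ℝ (Fin d) → ℝ) :
    tsupport (partialDeriv k f) ⊆ tsupport f :=
  tsupport_fderiv_apply_subset ℝ _

theorem continuous_divFormOp {a φ : EuclideanSpace ℝ (Fin d) → ℝ}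
    (ha : ∀ k, ContDiff ℝ 1 fun x => a x * partialDeriv k φ x) :
    Continuous (divFormOp a φ) :=
  (continuous_finsetSum _ fun k _ => continuous_partialDeriv (ha k) k).neg

theorem tsupport_divFormOp_subset (a φ : EuclideanSpace ℝ (Fin d) → ℝ) :
    tsupport (divFormOp a φ) ⊆ tsupport φ := by
  refine closure_minimal (fun x hx => ?_) (isClosed_tsupport φ)
  by_contra hx'
  refine hx ?_
  rw [divFormOp, Finset.sum_eq_zero, neg_zero]
  intro k _
  refine image_eq_zero_of_notMem_tsupport fun h => hx' ?_
  exact tsupport_partialDeriv_subset k φ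
    (tsupport_mul_subset_right (tsupport_partialDeriv_subset k _ h))

/-- Green's formula for the divergence form operator. -/
theorem integral_divFormOp_mul {a φ ψ : EuclideanSpace ℝ (Fin d) → ℝ}
    (ha : ∀ k, ContDiff ℝ 1 fun x => a x * partialDeriv k φ x)
    (hψ : ContDiff ℝ 1 ψ) (hψc : HasCompactSupport ψ) :
    ∫ x, divFormOp a φ x * ψ x = ∫ x, ∑ k, a x * partialDeriv k φ x * partialDeriv k ψ x := by
  have hi : ∀ k, Integrable fun x => a x * partialDeriv k φ x * partialDeriv k ψ x := fun k =>
    ((ha k).continuous.mul (continuous_partialDeriv hψ k)).integrable_of_hasCompactSupport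
      (hψc.partialDeriv k).mul_left
  have hi' : ∀ k, Integrable fun x =>
      partialDeriv k (fun y => a y * partialDeriv k φ y) x * ψ x := fun k =>
    ((continuous_partialDeriv (ha k) k).mul hψ.continuous).integrable_of_hasCompactSupport
      hψc.mul_left
  have hparts : ∀ k, ∫ x, a x * partialDeriv k φ x * partialDeriv k ψ x
      = -∫ x, partialDeriv k (fun y => a y * partialDeriv k φ y) x * ψ x := fun k =>
    integral_mul_fderiv_eq_neg_fderiv_mul_of_integrable (hi' k) (hi k)
      (((ha k).continuous.mul hψ.continuous).integrable_of_hasCompactSupport hψc.mul_left)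
      (fun x _ => (ha k).differentiable one_ne_zero x)
      (fun x _ => hψ.differentiable one_ne_zero x)
  rw [integral_finsetSum _ fun k _ => hi k, Finset.sum_congr rfl fun k _ => hparts k]
  simp only [divFormOp, neg_mul, Finset.sum_mul]
  rw [integral_neg, integral_finsetSum _ fun k _ => hi' k, Finset.sum_neg_distrib]

end DivergenceForm

/-! ### Products of radial functions with functions supported off K. -/

section Radial

variable {E : Type*} [NormedAddCommGroup E] [InnerProductSpace ℝ E] {K : Set E} {P : E → E}

theorem IsConvexProjection.contDiff_radial_mul (h : IsConvexProjection K P) {F : ℝ → ℝ}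
    (hF : ∀ s, 0 < s → ContDiffAt ℝ 1 F s) {χ : E → ℝ} (hχ : ContDiff ℝ 1 χ)
    (hχK : tsupport χ ⊆ Kᶜ) : ContDiff ℝ 1 fun x => F ‖x - P x‖ * χ x := by
  refine contDiff_of_contDiffAt_of_mem_tsupport fun x hx => ?_
  have hxK := hχK (tsupport_mul_subset_right hx)
  exact ((hF _ (h.norm_pos hxK)).comp x (h.contDiffAt_norm hxK)).mul hχ.contDiffAt

theorem IsConvexProjection.hasFDerivAt_radial_mul (h : IsConvexProjection K P) {F : ℝ → ℝ}
    {F' : ℝ} {x : E} (hx : x ∈ Kᶜ) (hF : HasDerivAt F F' ‖x - P x‖) {χ : E → ℝ} {χ' : E →L[ℝ] ℝ}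
    (hχ : HasFDerivAt χ χ' x) :
    HasFDerivAt (fun y => F ‖y - P y‖ * χ y)
      (F ‖x - P x‖ • χ' + χ x • (F' • ‖x - P x‖⁻¹ • innerSL ℝ (x - P x))) x :=
  (hF.comp_hasFDerivAt x (h.hasFDerivAt_norm hx)).mul hχ

end Radial

/-! ### The pointwise Rellich estimate. -/

section Rellich

variable {d : ℕ} {K : Set (EuclideanSpace ℝ (Fin d))}
  {P : EuclideanSpace ℝ (Fin d) → EuclideanSpace ℝ (Fin d)}

theorem boundaryDist_compl (h : IsConvexProjection K P) (x : EuclideanSpace ℝ (Fin d)) :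
    boundaryDist Kᶜ x = ‖x - P x‖ := by
  rw [boundaryDist, compl_compl, h.infDist_eq]

/-- Pointwise form of the Rellich estimate, up to the weak divergence of `x - P x`. -/
theorem rellich_pointwise (h : IsConvexProjection K P) {δ δ' m : ℝ} (hδ : δ < 2) (hδ' : δ' < 2)
    (hm : 1 ≤ m) (hpos : 0 < m + 2 * min δ δ' - 4) {φ : EuclideanSpace ℝ (Fin d) → ℝ}
    {x : EuclideanSpace ℝ (Fin d)} (hφ : DifferentiableAt ℝ φ x) (hx : x ∈ Kᶜ) :
    m * (m + 2 * min δ δ' - 4) / 4 * (rellichMultiplier δ δ' ‖x - P x‖ * φ x) ^ 2 ≤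
      ∑ k, weightProfile δ δ' ‖x - P x‖ * partialDeriv k φ x *
          partialDeriv k (fun y => rellichMultiplier δ δ' ‖y - P y‖ * φ y) x
        + (fderiv ℝ (fun y => rellichDensity ((m + 2 * min δ δ' - 4) / 2) δ δ' ‖y - P y‖ *
            φ y ^ 2) x (x - P x)
          + m * (rellichDensity ((m + 2 * min δ δ' - 4) / 2) δ δ' ‖x - P x‖ * φ x ^ 2)) := by
  have hs := h.norm_pos hx
  have hscalar := rellich_scalar_inequality hδ hδ' hm hpos hs
  have hmul := h.hasFDerivAt_radial_mul hx (hasDerivAt_rellichMultiplier δ δ' hs) hφ.hasFDerivAt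
  have hden := h.hasFDerivAt_radial_mul hx
    (hasDerivAt_rellichDensity ((m + 2 * min δ δ' - 4) / 2) δ δ' hs) (hφ.hasFDerivAt.pow 2)
  have hN : ∑ k, (x - P x) k ^ 2 = ‖x - P x‖ ^ 2 := by
    rw [EuclideanSpace.real_norm_sq_eq]
  -- Cauchy–Schwarz: (F·∇φ)² ≤ D²|∇φ|².
  have hCS := Finset.sum_mul_sq_le_sq_mul_sq Finset.univ (fun k => partialDeriv k φ x)
    (fun k => (x - P x) k)
  have hS := fderiv_apply_eq_sum_partialDeriv φ x (x - P x)
  have hin := real_inner_self_eq_norm_sq (x - P x)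
  have hcomp : ∀ k, inner ℝ (x - P x) (EuclideanSpace.single k (1 : ℝ)) = (x - P x) k := by
    intro k; simp [EuclideanSpace.inner_single_right]
  have hW : weightProfile δ δ' ‖x - P x‖
      = rellichMultiplier δ δ' ‖x - P x‖ * ‖x - P x‖ ^ 2 := by
    unfold rellichMultiplier; field_simp
  have hpart : ∀ k, partialDeriv k (fun y => rellichMultiplier δ δ' ‖y - P y‖ * φ y) x
      = rellichMultiplier δ δ' ‖x - P x‖ * partialDeriv k φ x
        + φ x * (rellichMultiplier δ δ' ‖x - P x‖ * (profileExponent δ δ' ‖x - P x‖ - 2)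
          / ‖x - P x‖ ^ 2 * (x - P x) k) := by
    intro k
    rw [partialDeriv, hmul.fderiv]
    simp only [add_apply, smul_apply, smul_eq_mul, innerSL_apply_apply, hcomp]
    rw [partialDeriv]
    field_simp
  rw [hden.fderiv]
  simp only [hpart, hW, add_apply, smul_apply, smul_eq_mul, innerSL_apply_apply,
    hin]
  rw [hS]
  set D := ‖x - P x‖
  set S := ∑ k, partialDeriv k φ x * (x - P x) k with hSdef
  set Q := ∑ k, partialDeriv k φ x ^ 2 with hQdef
  set W := rellichMultiplier δ δ' D with hWdef
  set e := profileExponent δ δ' D with he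
  have hsum : ∑ k, W * D ^ 2 * partialDeriv k φ x * (W * partialDeriv k φ x
      + φ x * (W * (e - 2) / D ^ 2 * (x - P x) k)) = W ^ 2 * (D ^ 2 * Q + (e - 2) * φ x * S) := by
    rw [hSdef, hQdef, Finset.mul_sum, Finset.mul_sum, ← Finset.sum_add_distrib, Finset.mul_sum]
    refine Finset.sum_congr rfl fun k _ => ?_
    field_simp
  rw [hsum, rellichDensity, ← hWdef, ← he]
  rw [hN] at hCS
  obtain ⟨μ, hμ⟩ : ∃ μ, μ = m + 2 * min δ δ' - 4 := ⟨_, rfl⟩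
  obtain ⟨q, hq⟩ : ∃ q, q = (δ' - δ) * D / (1 + D) ^ 2 := ⟨_, rfl⟩
  rw [← hμ, ← hq] at hscalar ⊢
  -- The completed square costs (μ/2)²φ², exactly the extra term on the left of the scalar
  -- inequality.
  have h1 : 0 ≤ (S + μ / 2 * φ x) ^ 2 := sq_nonneg _
  have h2 : 0 ≤ φ x ^ 2 * ((m + 2 * (e - 2)) * (μ / 2 + (2 - e) / 2) - q / 2
      - (m * μ / 4 + (μ / 2) ^ 2)) := mul_nonneg (sq_nonneg _) (by linarith)
  have h3 : 0 ≤ W ^ 2 * (D ^ 2 * Q + μ * φ x * S + (μ / 2) ^ 2 * φ x ^ 2 +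
      φ x ^ 2 * ((m + 2 * (e - 2)) * (μ / 2 + (2 - e) / 2) - q / 2
      - (m * μ / 4 + (μ / 2) ^ 2))) := by
    refine mul_nonneg (sq_nonneg _) ?_
    nlinarith
  refine le_of_sub_nonneg (h3.trans_eq ?_)
  field_simp
  ring

end Rellich

/-! ### Integrated Rellich inequality. -/

section RellichInequality

variable {d : ℕ} {K : Set (EuclideanSpace ℝ (Fin d))}
  {P : EuclideanSpace ℝ (Fin d) → EuclideanSpace ℝ (Fin d)}

theorem contDiff_partialDeriv {φ : EuclideanSpace ℝ (Fin d) → ℝ} (hφ : ContDiff ℝ 2 φ)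
    (k : Fin d) : ContDiff ℝ 1 (partialDeriv k φ) :=
  (hφ.fderiv_right (m := 1) (by norm_num)).clm_apply contDiff_const

theorem IsConvexProjection.contDiff_weight_mul_partialDeriv (h : IsConvexProjection K P)
    (δ δ' : ℝ) {φ : EuclideanSpace ℝ (Fin d) → ℝ} (hφ : IsCc2 Kᶜ φ) (k : Fin d) :
    ContDiff ℝ 1 fun x => weight Kᶜ δ δ' x * partialDeriv k φ x := by
  simp only [weight, boundaryDist_compl h]
  exact h.contDiff_radial_mul (fun s hs => contDiffAt_weightProfile δ δ' hs)
    (contDiff_partialDeriv hφ.contDiff k)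
    ((tsupport_partialDeriv_subset k φ).trans hφ.tsupport_subset)

/-- The Rellich inequality in quadratic form, with the codimension replaced by any lower bound
`m ≥ 1` for the weak divergence of `x - P x`. -/
theorem IsConvexProjection.rellich_form (h : IsConvexProjection K P) {δ δ' m : ℝ} (hδ : δ < 2)
    (hδ' : δ' < 2) (hm : 1 ≤ m) (hpos : 0 < m + 2 * min δ δ' - 4)
    (hdiv : ∀ g : EuclideanSpace ℝ (Fin d) → ℝ, ContDiff ℝ 1 g → HasCompactSupport g →
      tsupport g ⊆ Kᶜ → (∀ x, 0 ≤ g x) → ∫ x, fderiv ℝ g x (x - P x) ≤ -(m * ∫ x, g x))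
    {φ : EuclideanSpace ℝ (Fin d) → ℝ} (hφ : IsCc2 Kᶜ φ) :
    m * (m + 2 * min δ δ' - 4) / 4 * ∫ x, (rellichMultiplier δ δ' ‖x - P x‖ * φ x) ^ 2 ≤
      ∫ x, divFormOp (weight Kᶜ δ δ') φ x * (rellichMultiplier δ δ' ‖x - P x‖ * φ x) := by
  have hφ1 : ContDiff ℝ 1 φ := hφ.contDiff.of_le (by norm_num)
  have ha := h.contDiff_weight_mul_partialDeriv δ δ' hφ
  have hψ := h.contDiff_radial_mul (fun s hs => contDiffAt_rellichMultiplier δ δ' hs) hφ1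
    hφ.tsupport_subset
  have hψc : HasCompactSupport fun x => rellichMultiplier δ δ' ‖x - P x‖ * φ x :=
    hφ.hasCompactSupport.mul_left
  set α := (m + 2 * min δ δ' - 4) / 2 with hα
  have hsq : tsupport (fun x => φ x ^ 2) ⊆ tsupport φ := by
    simp only [pow_two]
    exact tsupport_mul_subset_left
  have hg := h.contDiff_radial_mul (fun s hs => contDiffAt_rellichDensity α δ δ' hs)
    (hφ1.pow 2) (hsq.trans hφ.tsupport_subset)
  have hgs : tsupport (fun x => rellichDensity α δ δ' ‖x - P x‖ * φ x ^ 2) ⊆ tsupport φ :=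
    tsupport_mul_subset_right.trans hsq
  have hgc : HasCompactSupport fun x => rellichDensity α δ δ' ‖x - P x‖ * φ x ^ 2 :=
    hφ.hasCompactSupport.of_isClosed_subset (isClosed_tsupport _) hgs
  -- The test function is nonnegative because e < 2 and α > 0.
  have hweak := hdiv _ hg hgc (hgs.trans hφ.tsupport_subset) fun x => by
    by_cases hx : x ∈ Kᶜ
    · have h1 := profileExponent_lt_two hδ hδ' (h.norm_pos hx)
      exact mul_nonneg (mul_nonneg (sq_nonneg _) (by linarith)) (sq_nonneg _)
    · have : φ x = 0 :=
        image_eq_zero_of_notMem_tsupport fun hx' => hx (hφ.tsupport_subset hx')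
      simp [this]
  have hgi := hg.continuous.integrable_of_hasCompactSupport (μ := volume) hgc
  have hg'i : Integrable fun x =>
      fderiv ℝ (fun y => rellichDensity α δ δ' ‖y - P y‖ * φ y ^ 2) x (x - P x) := by
    refine Continuous.integrable_of_hasCompactSupport
      ((hg.continuous_fderiv one_ne_zero).clm_apply h.continuous_sub) ?_
    exact (hgc.fderiv ℝ).mono fun x hx hx0 => hx (by simp [hx0])
  have hTi : Integrable fun x => ∑ k, weight Kᶜ δ δ' x * partialDeriv k φ x *
      partialDeriv k (fun y => rellichMultiplier δ δ' ‖y - P y‖ * φ y) x :=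
    integrable_finsetSum _ fun k _ =>
      ((ha k).continuous.mul (continuous_partialDeriv hψ k)).integrable_of_hasCompactSupport
        (hψc.partialDeriv k).mul_left
  have hψ2 : Integrable fun x => (rellichMultiplier δ δ' ‖x - P x‖ * φ x) ^ 2 := by
    simp only [pow_two]
    exact (hψ.continuous.mul hψ.continuous).integrable_of_hasCompactSupport hψc.mul_left
  rw [integral_divFormOp_mul ha hψ hψc]
  have hpt : ∀ x, m * (m + 2 * min δ δ' - 4) / 4 *
      (rellichMultiplier δ δ' ‖x - P x‖ * φ x) ^ 2 ≤
      ∑ k, weight Kᶜ δ δ' x * partialDeriv k φ x *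
          partialDeriv k (fun y => rellichMultiplier δ δ' ‖y - P y‖ * φ y) x
        + (fderiv ℝ (fun y => rellichDensity α δ δ' ‖y - P y‖ * φ y ^ 2) x (x - P x)
          + m * (rellichDensity α δ δ' ‖x - P x‖ * φ x ^ 2)) := fun x => by
    by_cases hx : x ∈ Kᶜ
    · have := rellich_pointwise h hδ hδ' hm hpos (hφ1.differentiable one_ne_zero x) hx
      simpa only [weight, boundaryDist_compl h] using this
    · have hx' : x ∉ tsupport φ := fun hx' => hx (hφ.tsupport_subset hx')
      have h1 : φ x = 0 := image_eq_zero_of_notMem_tsupport hx'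
      have h2 : x - P x = 0 := h.sub_eq_zero (not_not.1 hx)
      have h3 : ∀ k, partialDeriv k φ x = 0 := fun k =>
        image_eq_zero_of_notMem_tsupport fun hk => hx' (tsupport_partialDeriv_subset k φ hk)
      rw [h2, map_zero]
      simp [h1, h3]
  have hmono := integral_mono (hψ2.const_mul (m * (m + 2 * min δ δ' - 4) / 4))
    (hTi.add (hg'i.add (hgi.const_mul m))) hpt
  rw [integral_const_mul, integral_add' hTi (hg'i.add (hgi.const_mul m)),
    integral_add' hg'i (hgi.const_mul m), integral_const_mul] at hmono
  linarith

/-- Integrating 2Cuv ≤ u² + C²v² avoids dividing by the norm of v. -/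
theorem sq_mul_integral_sq_le_of_mul_integral_sq_le {X : Type*} [MeasurableSpace X]
    {μ : Measure X} {u v : X → ℝ} {C : ℝ} (hC : 0 ≤ C) (hu : Integrable (fun x => u x ^ 2) μ)
    (hv : Integrable (fun x => v x ^ 2) μ) (huv : Integrable (fun x => u x * v x) μ)
    (h : C * ∫ x, v x ^ 2 ∂μ ≤ ∫ x, u x * v x ∂μ) :
    C ^ 2 * ∫ x, v x ^ 2 ∂μ ≤ ∫ x, u x ^ 2 ∂μ := by
  have h1 := integral_mono (huv.const_mul (2 * C)) (hu.add (hv.const_mul (C ^ 2))) fun x => by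
    simp only [Pi.add_apply]
    nlinarith [sq_nonneg (u x - C * v x)]
  simp only [Pi.add_apply] at h1
  rw [integral_const_mul, integral_add hu (hv.const_mul _), integral_const_mul] at h1
  nlinarith [mul_le_mul_of_nonneg_left h hC]

end RellichInequality

/-! ### The Rellich inequality. -/

theorem proposition4p8 (d : ℕ) (K : Set (EuclideanSpace ℝ (Fin d)))
    (hK_closed : IsClosed K) (hK_convex : Convex ℝ K) (hK_nonempty : K.Nonempty)
    (δ δ' : ℝ) (hδ : δ ∈ Set.Ico (0 : ℝ) 2) (hδ' : δ' ∈ Set.Ico (0 : ℝ) 2)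
    (hpos : 0 < (d : ℝ) - boundaryDim Kᶜ + 2 * min δ δ' - 4)
    (φ : EuclideanSpace ℝ (Fin d) → ℝ) (hφ : IsCc2 Kᶜ φ) :
    -- `H φ` is classically defined on `Ω`, and both integrals are finite
    (∀ k : Fin d, DifferentiableOn ℝ (fun x => weight Kᶜ δ δ' x * partialDeriv k φ x) Kᶜ) ∧
    IntegrableOn (fun x => |divFormOp (weight Kᶜ δ δ') φ x| ^ 2) Kᶜ volume ∧
    IntegrableOn (fun x => |weight Kᶜ δ δ' x / boundaryDist Kᶜ x ^ 2 * φ x| ^ 2) Kᶜ volume ∧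
    -- the inequality
    (((d : ℝ) - boundaryDim Kᶜ) * ((d : ℝ) - boundaryDim Kᶜ + 2 * min δ δ' - 4) / 4) ^ 2 *
        ∫ x in Kᶜ, |weight Kᶜ δ δ' x / boundaryDist Kᶜ x ^ 2 * φ x| ^ 2
      ≤ ∫ x in Kᶜ, |divFormOp (weight Kᶜ δ δ') φ x| ^ 2 := by
  obtain ⟨P, h⟩ := exists_isConvexProjection hK_closed hK_convex hK_nonempty
  have hφ1 : ContDiff ℝ 1 φ := hφ.contDiff.of_le (by norm_num)
  have ha := h.contDiff_weight_mul_partialDeriv δ δ' hφ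
  have hψ := h.contDiff_radial_mul (fun s hs => contDiffAt_rellichMultiplier δ δ' hs) hφ1
    hφ.tsupport_subset
  have hψc : HasCompactSupport fun x => rellichMultiplier δ δ' ‖x - P x‖ * φ x :=
    hφ.hasCompactSupport.mul_left
  have hHc : HasCompactSupport (divFormOp (weight Kᶜ δ δ') φ) :=
    hφ.hasCompactSupport.of_isClosed_subset (isClosed_tsupport _) (tsupport_divFormOp_subset _ φ)
  have hH := continuous_divFormOp ha
  have hψ2 : Integrable fun x => (rellichMultiplier δ δ' ‖x - P x‖ * φ x) ^ 2 := by
    simp only [pow_two]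
    exact (hψ.continuous.mul hψ.continuous).integrable_of_hasCompactSupport hψc.mul_left
  have hH2 : Integrable fun x => divFormOp (weight Kᶜ δ δ') φ x ^ 2 := by
    simp only [pow_two]
    exact (hH.mul hH).integrable_of_hasCompactSupport hHc.mul_left
  have hHψ : Integrable fun x =>
      divFormOp (weight Kᶜ δ δ') φ x * (rellichMultiplier δ δ' ‖x - P x‖ * φ x) :=
    (hH.mul hψ.continuous).integrable_of_hasCompactSupport hψc.mul_left
  have hmult : ∀ x, weight Kᶜ δ δ' x / boundaryDist Kᶜ x ^ 2
      = rellichMultiplier δ δ' ‖x - P x‖ := fun x => by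
    rw [weight, boundaryDist_compl h, rellichMultiplier]
  simp only [hmult, sq_abs]
  refine ⟨fun k => ((ha k).differentiable one_ne_zero).differentiableOn, hH2.integrableOn,
    hψ2.integrableOn, ?_⟩
  by_cases huniv : K = Set.univ
  · simp [huniv]
  have hzero : ∀ x, x ∉ Kᶜ → x ∉ tsupport φ := fun x hx hx' => hx (hφ.tsupport_subset hx')
  rw [setIntegral_eq_integral_of_forall_compl_eq_zero fun x hx => by
      simp [image_eq_zero_of_notMem_tsupport (hzero x hx)],
    setIntegral_eq_integral_of_forall_compl_eq_zero fun x hx => by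
      rw [image_eq_zero_of_notMem_tsupport fun hx' =>
        hzero x hx (tsupport_divFormOp_subset _ φ hx')]
      simp]
  obtain ⟨m, hm, hdim, hdiv⟩ := h.exists_codim_le_weakDiv hK_closed hK_convex hK_nonempty huniv
  have hmin : min δ δ' < 2 := (min_le_left _ _).trans_lt hδ.2
  have hposm : 0 < m + 2 * min δ δ' - 4 := by linarith
  have hform := h.rellich_form hδ.2 hδ'.2 hm hposm hdiv hφ
  have hmain := sq_mul_integral_sq_le_of_mul_integral_sq_le (by positivity) hH2 hψ2 hHψ hform
  refine le_trans ?_ hmain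
  -- As min δ δ' < 2, `hpos` makes the codimension nonnegative; both factors of the constant are
  -- then nonnegative and increase when it is replaced by m.
  have hcodim : 0 ≤ (d : ℝ) - boundaryDim Kᶜ := by linarith
  gcongr
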